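/- Let $F \subseteq [0,1]$ and let $\mu$ be a Borel probability measure supported on $F$, i.e. $\mu(\mathbb{R}\setminus F)=0$, with Fourier transform $\widehat{\mu}(t) = \int e^{-2\pi i t x}\,\mathrm{d}\mu(x)$ for $t\in\mathbb{R}$. Let $\mathcal{A}=(q_n)_{n\in\mathbb{N}}$ be a lacunary sequence of positive integers, i.e. there is a constant $K>1$ with $q_{n+1}/q_n \ge K$ for all $n$. Let $\gamma\in[0,1]$ and let $\psi:\mathbb{N}\to(0,1]$ be any function. Suppose that there is a constant $A>2$ such that $$\widehat{\mu}(t) = O\big((\log|t|)^{-A}\big) \quad\text{as } |t|\to\infty .$$ Write $\|\alpha\| = \min\{|\alpha-m| : m\in\mathbb{Z}\}$ and $$W_{\mathcal{A}}(\gamma;\psi) = \{x\in[0,1] : \|q_n x-\gamma\|\le\psi(q_n) \text{ for infinitely many } n\in\mathbb{N}\}.$$ Then $$\mu\big(W_{\mathcal{A}}(\gamma;\psi)\cap F\big) = \begin{cases} 0 & \text{if } \sum_{n=1}^\infty \psi(q_n) < \infty,\\ 1 & \text{if } \sum_{n=1}^\infty \psi(q_n) = \infty. \end{cases}$$ -/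

import Mathlib

open Real Set Filter Topology MeasureTheory Asymptotics

namespace LacunaryApprox

/-- The distance from a real number to the nearest integer. -/
noncomputable def distInt (α : ℝ) : ℝ := |α - (round α : ℝ)|

/-- `distInt α` is the minimum of `|α - m|` over the integers `m`. -/
theorem distInt_isLeast (α : ℝ) :
    IsLeast (Set.range fun m : ℤ => |α - (m : ℝ)|) (distInt α) := by
  refine ⟨⟨round α, rfl⟩, ?_⟩
  rintro _ ⟨m, rfl⟩
  exact round_le α m

/-- The Fourier transform `t ↦ ∫ exp (-2πitx) dμ(x)` of a measure on the real line. -/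
noncomputable def fourierTransform (μ : Measure ℝ) (t : ℝ) : ℂ :=
  ∫ x, Complex.exp (-2 * (Real.pi : ℂ) * Complex.I * (t : ℂ) * (x : ℂ)) ∂μ

/-- A sequence of positive integers (indexed here from `0`) is lacunary if the ratios of
consecutive terms are bounded below by a constant greater than `1`. -/
def IsLacunary (q : ℕ → ℕ) : Prop :=
  (∀ n, 0 < q n) ∧ ∃ K : ℝ, 1 < K ∧ ∀ n, K ≤ (q (n + 1) : ℝ) / (q n : ℝ)

/-- The set of `x ∈ [0, 1]` such that `‖q n * x - γ‖ ≤ ψ (q n)` for infinitely many indices `n`,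
where `‖·‖` is the distance to the nearest integer. -/
def wellApproximable (q : ℕ → ℕ) (γ : ℝ) (ψ : ℕ → ℝ) : Set ℝ :=
  {x | x ∈ Set.Icc (0 : ℝ) 1 ∧ {n : ℕ | distInt ((q n : ℝ) * x - γ) ≤ ψ (q n)}.Infinite}

end LacunaryApprox

namespace LacunaryApprox

/-! Tents replace the indicators of `‖y‖ ≤ δ`: their cosine coefficients are nonnegative with sum at
most `1`, so integrals against `μ` only involve `μ̂` at integer combinations of the `q n`, with
bounded total weight. Lacunarity turns logarithmic decay into decay of order `n ^ (-A)` at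
frequencies above `R ^ n / 2`, where `R ^ 2 = K`.

If the sum converges, the `n`-th set has measure at most `4 ψ (q n) + O(n ^ (-A))`
(`measureReal_distInt_le`), and Borel–Cantelli applies.

If it diverges, the tents are summed as a weighted count of solutions. Once its variance is bounded
linearly in its mean (`exists_second_moment_bound`), Chebyshev's inequality makes the count
unbounded almost everywhere. A covariance with `m < n` splits over the frequencies `k q_m ± l q_n`.
Those of size at least `R ^ n / 2` cost `O(n ^ (-A))`; over all pairs this gives `∑ n ^ (1 - A)`,
which is where `A > 2` enters. The remaining near-coincidences form `nearSum`: `nearSum_le_sqrt`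
handles `n ≤ 2 m`, `nearSum_le_inv` handles `n > 2 m`, at the price of a factor `δ⁻¹` that
`exists_truncation` keeps polynomial in `n`. -/

/-! ### Tent functions and their cosine series. -/

/-- The tent function of width `δ` and height `1` around the integers; it vanishes for `δ = 0`. -/
noncomputable def tent (δ y : ℝ) : ℝ := max 0 (δ - distInt y) / δ

/-- The cosine coefficients of `tent δ`. -/
noncomputable def tentCoeff (δ : ℝ) (k : ℕ) : ℝ :=
  (1 - Real.cos (2 * π * k * δ)) / (π ^ 2 * (k : ℝ) ^ 2 * δ)

theorem hasSum_cos_div_sq {x : ℝ} (hx : x ∈ Set.Icc (0 : ℝ) 1) :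
    HasSum (fun n : ℕ => 1 / (n : ℝ) ^ 2 * Real.cos (2 * π * n * x))
      (π ^ 2 * (x ^ 2 - x + 1 / 6)) := by
  have h := hasSum_one_div_nat_pow_mul_cos (k := 1) one_ne_zero hx
  convert h using 1
  have : Polynomial.eval x (Polynomial.map (algebraMap ℚ ℝ) (Polynomial.bernoulli (2 * 1)))
      = x ^ 2 - x + 1 / 6 := by
    simp [Polynomial.bernoulli, Finset.sum_range_succ, bernoulli_two, bernoulli_one]
    ring
  rw [this, show ((Nat.factorial (2 * 1) : ℕ) : ℝ) = 2 by norm_num [Nat.factorial]]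
  ring

theorem distInt_nonneg (y : ℝ) : 0 ≤ distInt y := abs_nonneg _

theorem distInt_le_half (y : ℝ) : distInt y ≤ 1 / 2 := abs_sub_round y

theorem cos_mul_distInt (k : ℕ) (y : ℝ) :
    Real.cos (2 * π * k * distInt y) = Real.cos (2 * π * k * y) := by
  unfold distInt
  have h : Real.cos (2 * π * k * |y - round y|) = Real.cos (2 * π * k * (y - round y)) := by
    rcases abs_choice (y - round y) with h | h <;> rw [h]
    rw [mul_neg, Real.cos_neg]
  rw [h]
  have : 2 * π * k * (y - round y) = 2 * π * k * y - ((k * round y : ℤ) : ℝ) * (2 * π) := by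
    push_cast; ring
  rw [this, Real.cos_sub_int_mul_two_pi]

/-- The tent is, up to scaling, a second difference with step `δ` of the periodic Bernoulli
polynomial `x ^ 2 - x + 1 / 6`. The term `k = 0` vanishes because division by zero gives `0`, hence
the mean `δ` is subtracted. -/
theorem hasSum_tentCoeff {δ : ℝ} (h0 : 0 ≤ δ) (h1 : δ ≤ 1 / 2) (y : ℝ) :
    HasSum (fun k : ℕ => tentCoeff δ k * Real.cos (2 * π * k * y)) (tent δ y - δ) := by
  rcases h0.eq_or_lt with rfl | hδ
  · simp [tent, tentCoeff]
  have hu0 := distInt_nonneg y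
  have hu1 := distInt_le_half y
  simp_rw [← cos_mul_distInt _ y]
  unfold tent
  set u := distInt y
  have e1 := hasSum_cos_div_sq (x := u + δ) ⟨by linarith, by linarith⟩
  -- The absolute value keeps the argument in `[0, 1]`, and cosine is even; the kink of the tent
  -- comes from it.
  have e2 := hasSum_cos_div_sq (x := |u - δ|)
    ⟨abs_nonneg _, by rw [abs_le]; constructor <;> linarith⟩
  have e3 := hasSum_cos_div_sq (x := u) ⟨by linarith, by linarith⟩
  have e := (((e1.add e2).sub (e3.mul_left 2)).mul_left (-1 / (2 * π ^ 2 * δ)))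
  have hp : π ≠ 0 := Real.pi_ne_zero
  have hv : max 0 (δ - u) / δ - δ = -1 / (2 * π ^ 2 * δ) *
      (π ^ 2 * ((u + δ) ^ 2 - (u + δ) + 1 / 6) + π ^ 2 * (|u - δ| ^ 2 - |u - δ| + 1 / 6) -
        2 * (π ^ 2 * (u ^ 2 - u + 1 / 6))) := by
    rw [sq_abs]
    rcases le_total u δ with h | h
    · rw [max_eq_right (by linarith), abs_of_nonpos (by linarith)]
      field_simp
      ring
    · rw [max_eq_left (by linarith), abs_of_nonneg (by linarith)]
      field_simp
      ring
  rw [hv]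
  have hk (k : ℕ) : tentCoeff δ k * Real.cos (2 * π * k * u) = -1 / (2 * π ^ 2 * δ) *
      (1 / (k : ℝ) ^ 2 * Real.cos (2 * π * k * (u + δ)) +
        1 / (k : ℝ) ^ 2 * Real.cos (2 * π * k * |u - δ|) -
        2 * (1 / (k : ℝ) ^ 2 * Real.cos (2 * π * k * u))) := by
    have hc : Real.cos (2 * π * k * |u - δ|) = Real.cos (2 * π * k * (u - δ)) := by
      rcases abs_choice (u - δ) with h | h <;> rw [h]
      rw [mul_neg, Real.cos_neg]
    rw [hc, mul_add (2 * π * k), mul_sub (2 * π * k), Real.cos_add, Real.cos_sub]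
    unfold tentCoeff
    rcases Nat.eq_zero_or_pos k with rfl | hk
    · simp
    have hk' : (k : ℝ) ≠ 0 := by positivity
    field_simp
    ring
  simpa only [hk] using e

theorem tentCoeff_nonneg {δ : ℝ} (h0 : 0 ≤ δ) (k : ℕ) : 0 ≤ tentCoeff δ k :=
  div_nonneg (by linarith [Real.cos_le_one (2 * π * k * δ)]) (by positivity)

theorem tentCoeff_zero (δ : ℝ) : tentCoeff δ 0 = 0 := by simp [tentCoeff]

theorem tentCoeff_le_two_mul {δ : ℝ} (h0 : 0 ≤ δ) (k : ℕ) : tentCoeff δ k ≤ 2 * δ := by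
  rcases h0.eq_or_lt with rfl | hδ
  · simp [tentCoeff]
  rcases Nat.eq_zero_or_pos k with rfl | hk
  · rw [tentCoeff_zero]; positivity
  unfold tentCoeff
  rw [div_le_iff₀ (by positivity)]
  have := Real.one_sub_sq_div_two_le_cos (x := 2 * π * k * δ)
  nlinarith

theorem tentCoeff_le_inv {δ : ℝ} (h0 : 0 ≤ δ) (k : ℕ) :
    tentCoeff δ k ≤ δ⁻¹ * ((k : ℝ) ^ 2)⁻¹ := by
  rcases h0.eq_or_lt with rfl | hδ
  · simp [tentCoeff]
  rcases Nat.eq_zero_or_pos k with rfl | hk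
  · rw [tentCoeff_zero]; positivity
  have hk' : (0 : ℝ) < k := by positivity
  unfold tentCoeff
  rw [div_le_iff₀ (by positivity)]
  have h3 := Real.neg_one_le_cos (2 * π * k * δ)
  have hp := Real.pi_gt_three
  have : δ⁻¹ * ((k : ℝ) ^ 2)⁻¹ * (π ^ 2 * k ^ 2 * δ) = π ^ 2 := by field_simp
  rw [this]
  nlinarith

theorem tent_nonneg {δ : ℝ} (h0 : 0 ≤ δ) (y : ℝ) : 0 ≤ tent δ y :=
  div_nonneg (le_max_left _ _) h0

theorem tent_le_one {δ : ℝ} (h0 : 0 ≤ δ) (y : ℝ) : tent δ y ≤ 1 :=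
  div_le_one_of_le₀ (max_le h0 (by linarith [distInt_nonneg y])) h0

theorem distInt_lt_of_tent_pos {δ y : ℝ} (h : 0 < tent δ y) : distInt y < δ := by
  by_contra! hc
  rw [tent, max_eq_left (by linarith)] at h
  simp at h

/-- At `y = 0` every cosine is `1`, so the full series of nonnegative terms sums to `tent δ 0 - δ ≤
1`. -/
theorem sum_tentCoeff_le_one {δ : ℝ} (h0 : 0 ≤ δ) (h1 : δ ≤ 1 / 2) (s : Finset ℕ) :
    ∑ k ∈ s, tentCoeff δ k ≤ 1 := by
  have h := hasSum_tentCoeff h0 h1 0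
  simp only [mul_zero, Real.cos_zero, mul_one] at h
  have := sum_le_hasSum s (fun k _ => tentCoeff_nonneg h0 k) h
  linarith [tent_le_one h0 0]

theorem continuous_distInt : Continuous distInt := by
  have : distInt = fun x : ℝ => ‖(x : UnitAddCircle)‖ := by
    funext x; rw [UnitAddCircle.norm_eq]; rfl
  rw [this]
  exact continuous_norm.comp (AddCircle.continuous_mk' 1)

theorem continuous_tent (δ : ℝ) : Continuous (tent δ) :=
  (continuous_const.max (continuous_const.sub continuous_distInt)).div_const _

/-- The partial sums of the cosine series of `tent δ - δ`. -/
noncomputable def tentPartial (δ : ℝ) (L : ℕ) (y : ℝ) : ℝ :=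
  ∑ k ∈ Finset.range L, tentCoeff δ k * Real.cos (2 * π * k * y)

theorem abs_tentPartial_le_one {δ : ℝ} (h0 : 0 ≤ δ) (h1 : δ ≤ 1 / 2) (L : ℕ) (y : ℝ) :
    |tentPartial δ L y| ≤ 1 := by
  refine (Finset.abs_sum_le_sum_abs _ _).trans
    (le_trans (Finset.sum_le_sum fun k _ => ?_) (sum_tentCoeff_le_one h0 h1 (Finset.range L)))
  rw [abs_mul, abs_of_nonneg (tentCoeff_nonneg h0 k)]
  exact mul_le_of_le_one_right (tentCoeff_nonneg h0 k) (Real.abs_cos_le_one _)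

theorem tendsto_tentPartial {δ : ℝ} (h0 : 0 ≤ δ) (h1 : δ ≤ 1 / 2) (y : ℝ) :
    Tendsto (fun L => tentPartial δ L y) atTop (𝓝 (tent δ y - δ)) :=
  (hasSum_tentCoeff h0 h1 y).tendsto_sum_nat

theorem continuous_tentPartial (δ : ℝ) (L : ℕ) : Continuous (tentPartial δ L) := by
  unfold tentPartial; fun_prop

/-! ### Sums of coefficients -/

/-- The function `√x / (1 + √x)` is concave, so its increment is at least `ε` times its derivative
at the right endpoint. Being bounded by `1`, it gives a telescoping majorant. -/
theorem sqrt_telescope {x ε : ℝ} (hx : 0 ≤ x) (hε : 0 < ε) :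
    ε / (2 * √(x + ε) * (1 + √(x + ε)) ^ 2) ≤
      √(x + ε) / (1 + √(x + ε)) - √x / (1 + √x) := by
  have hrs : √x ≤ √(x + ε) := Real.sqrt_le_sqrt (by linarith)
  have hr : 0 ≤ √x := Real.sqrt_nonneg _
  have hs : 0 < √(x + ε) := Real.sqrt_pos.mpr (by linarith)
  have er : √x ^ 2 = x := Real.sq_sqrt hx
  have es : √(x + ε) ^ 2 = x + ε := Real.sq_sqrt (by linarith)
  generalize √x = r at *
  generalize √(x + ε) = s at *
  have he : ε = (s - r) * (s + r) := by linarith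
  have : s / (1 + s) - r / (1 + r) = (s - r) / ((1 + s) * (1 + r)) := by
    field_simp; ring
  rw [this, he, div_le_div_iff₀ (by positivity) (by positivity)]
  have h1 : 0 ≤ s - r := by linarith
  calc (s - r) * (s + r) * ((1 + s) * (1 + r))
      ≤ (s - r) * (s + s) * ((1 + s) * (1 + s)) := by gcongr
    _ = _ := by ring

theorem tentCoeff_div_sqrt_le {ε : ℝ} (hε : 0 < ε) (l : ℕ) :
    tentCoeff ε (l + 1) / √((l + 1 : ℕ) : ℝ) ≤
      16 * √ε * (√(ε * (l + 1 : ℕ)) / (1 + √(ε * (l + 1 : ℕ))) -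
        √(ε * l) / (1 + √(ε * l))) := by
  have ht := sqrt_telescope (x := ε * l) (by positivity) hε
  have hx : ε * l + ε = ε * (l + 1 : ℕ) := by push_cast; ring
  rw [hx] at ht
  refine le_trans ?_ (mul_le_mul_of_nonneg_left ht (by positivity))
  have b1 := tentCoeff_le_two_mul hε.le (l + 1)
  have b2 := tentCoeff_le_inv hε.le (l + 1)
  have hl : (0 : ℝ) < (l + 1 : ℕ) := by positivity
  generalize ((l + 1 : ℕ) : ℝ) = y at *
  generalize tentCoeff ε (l + 1) = a at *
  rw [Real.sqrt_mul hε.le]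
  have e1 : √ε ^ 2 = ε := Real.sq_sqrt hε.le
  have e2 : √y ^ 2 = y := Real.sq_sqrt hl.le
  have hp : 0 < √ε := Real.sqrt_pos.mpr hε
  have hq : 0 < √y := Real.sqrt_pos.mpr hl
  generalize √ε = p at *
  generalize √y = r at *
  subst e1 e2
  rw [div_le_iff₀ hq]
  have : 16 * p * (p ^ 2 / (2 * (p * r) * (1 + p * r) ^ 2)) * r
      = 8 * p ^ 2 / (1 + p * r) ^ 2 := by
    field_simp; ring
  rw [this]
  have hs : 0 < p * r := by positivity
  -- The two coefficient bounds cross near `ε y = 1`, that is `p * r = 1`.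
  rcases le_total (p * r) 1 with h | h
  · refine b1.trans ?_
    rw [le_div_iff₀ (by positivity)]
    have : (1 + p * r) ^ 2 ≤ 4 := by nlinarith
    nlinarith [sq_nonneg p]
  · refine b2.trans ?_
    have : (p ^ 2)⁻¹ * ((r ^ 2) ^ 2)⁻¹ = p ^ 2 / (p * r) ^ 4 := by field_simp
    rw [this, div_le_div_iff₀ (by positivity) (by positivity)]
    have h4 : (1 + p * r) ^ 2 ≤ 4 * (p * r) ^ 2 := by nlinarith
    have h5 : (p * r) ^ 2 ≤ (p * r) ^ 4 := pow_le_pow_right₀ h (by norm_num)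
    have : (1 + p * r) ^ 2 ≤ 8 * (p * r) ^ 4 := by nlinarith [sq_nonneg (p*r)]
    nlinarith [sq_nonneg p]

theorem sum_tentCoeff_div_sqrt_le {ε : ℝ} (hε : 0 ≤ ε) (L : ℕ) :
    ∑ l ∈ Finset.range L, tentCoeff ε l / √(l : ℝ) ≤ 16 * √ε := by
  rcases hε.eq_or_lt with rfl | hε
  · simp [tentCoeff]
  calc ∑ l ∈ Finset.range L, tentCoeff ε l / √(l : ℝ)
      ≤ ∑ l ∈ Finset.range (L + 1), tentCoeff ε l / √(l : ℝ) :=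
        Finset.sum_le_sum_of_subset_of_nonneg (Finset.range_mono (by omega))
          fun k _ _ => div_nonneg (tentCoeff_nonneg hε.le k) (Real.sqrt_nonneg _)
    _ = ∑ l ∈ Finset.range L, tentCoeff ε (l + 1) / √((l + 1 : ℕ) : ℝ) := by
        rw [Finset.sum_range_succ', tentCoeff_zero]; simp
    _ ≤ ∑ l ∈ Finset.range L, 16 * √ε * (√(ε * (l + 1 : ℕ)) / (1 + √(ε * (l + 1 : ℕ))) -
        √(ε * l) / (1 + √(ε * l))) :=
        Finset.sum_le_sum fun l _ => tentCoeff_div_sqrt_le hε l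
    _ = 16 * √ε * (√(ε * L) / (1 + √(ε * L))) := by
        rw [← Finset.mul_sum,
          Finset.sum_range_sub fun l : ℕ => √(ε * l) / (1 + √(ε * l))]
        simp
    _ ≤ 16 * √ε := by
        refine mul_le_of_le_one_right (by positivity) ?_
        rw [div_le_one (by positivity)]
        linarith

theorem card_le_of_abs_sub_lt {s : Finset ℕ} {c r : ℝ} (hr : 0 ≤ r)
    (h : ∀ k ∈ s, |(k : ℝ) - c| < r) : (s.card : ℝ) ≤ 2 * r + 1 := by
  rcases s.eq_empty_or_nonempty with rfl | hs
  · simp; positivity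
  have hsub : s ⊆ Finset.Icc (s.min' hs) (s.max' hs) := fun k hk =>
    Finset.mem_Icc.mpr ⟨s.min'_le k hk, s.le_max' k hk⟩
  have hc := Finset.card_le_card hsub
  rw [Nat.card_Icc] at hc
  have hmm : s.min' hs ≤ s.max' hs := s.min'_le _ (s.max'_mem hs)
  have hc' : s.card + s.min' hs ≤ s.max' hs + 1 := by omega
  have hc'' : (s.card : ℝ) + (s.min' hs : ℕ) ≤ (s.max' hs : ℕ) + 1 := by exact_mod_cast hc'
  have h1 := abs_lt.mp (h _ (s.min'_mem hs))
  have h2 := abs_lt.mp (h _ (s.max'_mem hs))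
  linarith

/-! ### Cosine integrals and decay of the Fourier transform. -/

theorem norm_fourierTransform_le_one (μ : Measure ℝ) [IsProbabilityMeasure μ] (t : ℝ) :
    ‖fourierTransform μ t‖ ≤ 1 := by
  have h := norm_integral_le_of_norm_le_const (μ := μ) (C := 1)
    (f := fun x : ℝ => Complex.exp (-2 * (π : ℂ) * Complex.I * (t : ℂ) * (x : ℂ)))
    (Eventually.of_forall fun x => by
      have : -2 * (π : ℂ) * Complex.I * (t : ℂ) * (x : ℂ)
        = ((-2 * π * t * x : ℝ) : ℂ) * Complex.I := by push_cast; ring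
      rw [this, Complex.norm_exp_ofReal_mul_I])
  simpa [fourierTransform] using h

theorem abs_integral_cos_le (μ : Measure ℝ) [IsProbabilityMeasure μ] (t s : ℝ) :
    |∫ x, Real.cos (2 * π * (t * x) + s) ∂μ| ≤ ‖fourierTransform μ t‖ := by
  have hint : Integrable
      (fun x : ℝ => Complex.exp (-2 * (π : ℂ) * Complex.I * (t : ℂ) * (x : ℂ))) μ := by
    refine Integrable.of_bound (Continuous.aestronglyMeasurable (by fun_prop)) 1
      (Eventually.of_forall fun x => ?_)
    have : -2 * (π : ℂ) * Complex.I * (t : ℂ) * (x : ℂ)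
        = ((-2 * π * t * x : ℝ) : ℂ) * Complex.I := by push_cast; ring
    rw [this, Complex.norm_exp_ofReal_mul_I]
  have hre (x : ℝ) : Real.cos (2 * π * (t * x) + s) =
      RCLike.re (Complex.exp (((-s : ℝ) : ℂ) * Complex.I) *
        Complex.exp (-2 * (π : ℂ) * Complex.I * (t : ℂ) * (x : ℂ))) := by
    rw [← Complex.exp_add]
    have : ((-s : ℝ) : ℂ) * Complex.I + -2 * (π : ℂ) * Complex.I * (t : ℂ) * (x : ℂ)
        = ((-(2 * π * (t * x) + s) : ℝ) : ℂ) * Complex.I := by push_cast; ring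
    rw [this]
    simp only [RCLike.re_eq_complex_re]
    rw [Complex.exp_ofReal_mul_I_re, Real.cos_neg]
  simp_rw [hre]
  rw [integral_re (hint.const_mul _), integral_const_mul]
  refine (RCLike.abs_re_le_norm _).trans ?_
  rw [norm_mul, Complex.norm_exp_ofReal_mul_I, one_mul]
  rfl

/-- Logarithmic decay along geometric scales. -/
theorem exists_decay_bound (μ : Measure ℝ) [IsProbabilityMeasure μ] {A R : ℝ} (hA : 0 < A)
    (hR : 1 < R)
    (hdecay : fourierTransform μ =O[cocompact ℝ] fun t : ℝ => (Real.log |t|) ^ (-A)) :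
    ∃ C : ℝ, 0 < C ∧ ∀ (n : ℕ) (t : ℝ), R ^ n / 2 ≤ |t| →
      ‖fourierTransform μ t‖ ≤ C * ((n : ℝ) + 1) ^ (-A) := by
  obtain ⟨c, hc, hb⟩ := hdecay.exists_pos
  rw [IsBigOWith] at hb
  obtain ⟨r, hr⟩ := Metric.closedBall_compl_subset_of_mem_cocompact hb 0
  have hlR : 0 < Real.log R := Real.log_pos hR
  -- As `log (R ^ n / 2) = 4 b n - log 2`, this exceeds `b (n + 1)` once `3 b n ≥ log 2 + b`. For
  -- the finitely many smaller `n`, the trivial bound `1` is absorbed by the second summand of the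
  -- constant.
  set b := Real.log R / 4 with hbdef
  have hb0 : 0 < b := by positivity
  have e1 : ∀ᶠ n : ℕ in atTop, r < R ^ n / 2 :=
    ((tendsto_pow_atTop_atTop_of_one_lt hR).atTop_div_const (by norm_num)).eventually_gt_atTop r
  have e2 : ∀ᶠ n : ℕ in atTop, (Real.log 2 + b) / (3 * b) ≤ (n : ℝ) :=
    tendsto_natCast_atTop_atTop.eventually_ge_atTop _
  obtain ⟨n0, hn0⟩ := eventually_atTop.mp (e1.and e2)
  refine ⟨c * b ^ (-A) + ((n0 : ℝ) + 1) ^ A, by positivity, fun n t ht => ?_⟩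
  rcases lt_or_ge n n0 with h | h
  · refine (norm_fourierTransform_le_one μ t).trans ?_
    have h1 : (1 : ℝ) ≤ ((n0 : ℝ) + 1) ^ A * ((n : ℝ) + 1) ^ (-A) := by
      rw [Real.rpow_neg (by positivity), ← div_eq_mul_inv, one_le_div (by positivity)]
      have : (n : ℝ) ≤ n0 := by exact_mod_cast h.le
      gcongr
    have : 0 ≤ c * b ^ (-A) * ((n : ℝ) + 1) ^ (-A) := by positivity
    linarith [add_mul (c * b ^ (-A)) (((n0 : ℝ) + 1) ^ A) (((n : ℝ) + 1) ^ (-A))]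
  · obtain ⟨h1, h2⟩ := hn0 n h
    have hmem : t ∈ (Metric.closedBall (0 : ℝ) r)ᶜ := by
      simp only [mem_compl_iff, Metric.mem_closedBall, dist_zero_right, Real.norm_eq_abs]
      linarith
    have h3 := hr hmem
    simp only [mem_ofPred_eq] at h3
    have hRn : 0 < R ^ n := by positivity
    have hlog : b * ((n : ℝ) + 1) ≤ Real.log |t| := by
      have : Real.log (R ^ n / 2) ≤ Real.log |t| := Real.log_le_log (by positivity) ht
      rw [Real.log_div (by positivity) (by norm_num), Real.log_pow] at this
      rw [div_le_iff₀ (by positivity)] at h2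
      have : Real.log R = 4 * b := by rw [hbdef]; ring
      nlinarith
    have hpos : 0 < b * ((n : ℝ) + 1) := by positivity
    refine h3.trans ?_
    rw [Real.norm_of_nonneg (Real.rpow_nonneg (hpos.le.trans hlog) _)]
    calc c * Real.log |t| ^ (-A) ≤ c * (b * ((n : ℝ) + 1)) ^ (-A) :=
          mul_le_mul_of_nonneg_left
            (Real.rpow_le_rpow_of_nonpos hpos hlog (by linarith)) hc.le
      _ = c * b ^ (-A) * ((n : ℝ) + 1) ^ (-A) := by
          rw [Real.mul_rpow hb0.le (by positivity)]; ring
      _ ≤ _ := by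
          have : 0 ≤ ((n0 : ℝ) + 1) ^ A * ((n : ℝ) + 1) ^ (-A) := by positivity
          linarith [add_mul (c * b ^ (-A)) (((n0 : ℝ) + 1) ^ A) (((n : ℝ) + 1) ^ (-A))]

/-! ### Sums over near-coincidences of multiples of two terms -/

theorem pow_le_of_ratio {q : ℕ → ℕ} {K : ℝ} (hq : ∀ n, 0 < q n) (hK : 1 < K)
    (hr : ∀ n, K ≤ (q (n + 1) : ℝ) / (q n : ℝ)) {m n : ℕ} (h : m ≤ n) :
    K ^ (n - m) * q m ≤ q n := by
  induction n, h using Nat.le_induction with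
  | base => simp
  | succ n hmn ih =>
    have h1 := hr n
    have hqn : (0 : ℝ) < q n := by exact_mod_cast hq n
    rw [le_div_iff₀ hqn] at h1
    rw [Nat.sub_add_comm hmn, pow_succ]
    calc K ^ (n - m) * K * q m = K * (K ^ (n - m) * q m) := by ring
      _ ≤ K * q n := by gcongr
      _ ≤ _ := h1

theorem pow_le_of_ratio_zero {q : ℕ → ℕ} {K : ℝ} (hq : ∀ n, 0 < q n) (hK : 1 < K)
    (hr : ∀ n, K ≤ (q (n + 1) : ℝ) / (q n : ℝ)) (n : ℕ) : K ^ n ≤ q n := by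
  have h := pow_le_of_ratio hq hK hr (Nat.zero_le n)
  have h0 : (1 : ℝ) ≤ q 0 := by exact_mod_cast hq 0
  rw [Nat.sub_zero] at h
  have : 0 < K ^ n := by positivity
  nlinarith

/-- The weighted number of pairs `(k, l)` for which `k a` and `l b` are at distance less
than `T`. -/
noncomputable def nearSum (δ ε a b T : ℝ) (L : ℕ) : ℝ :=
  ∑ l ∈ Finset.range L, tentCoeff ε l *
    ∑ k ∈ (Finset.range L).filter (fun k : ℕ => |(k : ℝ) * a - l * b| < T), tentCoeff δ k

/-- A weighted sum over the `k` with `k a` close to `l b`, in terms of a pointwise bound for the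
coefficients. -/
theorem sum_near_le {δ a b T : ℝ} (ha : 0 < a) (hT : 0 ≤ T) {l L : ℕ}
    (hl : 0 < l) (hTb : T ≤ b / 2) {B : ℝ}
    (hB : ∀ k : ℕ, 0 < k → (l : ℝ) * (b / a) / 2 ≤ k → tentCoeff δ k ≤ B) :
    ∑ k ∈ (Finset.range L).filter (fun k : ℕ => |(k : ℝ) * a - l * b| < T), tentCoeff δ k
      ≤ (2 * (T / a) + 1) * max B 0 := by
  have hb : 0 ≤ b := by linarith
  have hl1 : (1 : ℝ) ≤ l := by exact_mod_cast hl
  set s := (Finset.range L).filter fun k : ℕ => |(k : ℝ) * a - l * b| < T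
  have hcard : (s.card : ℝ) ≤ 2 * (T / a) + 1 := by
    refine card_le_of_abs_sub_lt (c := l * b / a) (by positivity) fun k hk => ?_
    have h := (Finset.mem_filter.mp hk).2
    have : (k : ℝ) - l * b / a = (k * a - l * b) / a := by field_simp
    rw [this, abs_div, abs_of_pos ha]
    exact div_lt_div_of_pos_right h ha
  have hle : ∀ k ∈ s, tentCoeff δ k ≤ max B 0 := by
    intro k hk
    rcases Nat.eq_zero_or_pos k with rfl | hk0
    · rw [tentCoeff_zero]; exact le_max_right _ _
    have h := abs_lt.mp (Finset.mem_filter.mp hk).2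
    refine (hB k hk0 ?_).trans (le_max_left _ _)
    -- Since `T ≤ b / 2 ≤ l b / 2`, closeness of `k a` to `l b` forces `k a ≥ l b / 2`.
    have : (l : ℝ) * (b / a) / 2 = (l * b / 2) / a := by ring
    rw [this, div_le_iff₀ ha]
    nlinarith
  calc ∑ k ∈ s, tentCoeff δ k ≤ s.card • max B 0 := Finset.sum_le_card_nsmul _ _ _ hle
    _ = s.card * max B 0 := by rw [nsmul_eq_mul]
    _ ≤ _ := mul_le_mul_of_nonneg_right hcard (le_max_right _ _)

/-- Uses only the quadratic decay of the coefficients of `tent δ`: strong when `b / a` is large, but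
it costs `δ⁻¹`. -/
theorem nearSum_le_inv {δ ε a b T : ℝ} (hδ : 0 ≤ δ) (hε : 0 ≤ ε) (hε1 : ε ≤ 1 / 2)
    (ha : 0 < a) (hb : 0 < b) (hT : 0 ≤ T) (hTb : T ≤ b / 2) (L : ℕ) :
    nearSum δ ε a b T L ≤ (2 * (T / a) + 1) * (δ⁻¹ * (4 * ((b / a) ^ 2)⁻¹)) := by
  set B := δ⁻¹ * (4 * ((b / a) ^ 2)⁻¹)
  have hB0 : 0 ≤ B := by positivity
  have h1 : ∀ l ∈ Finset.range L, tentCoeff ε l *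
      ∑ k ∈ (Finset.range L).filter (fun k : ℕ => |(k : ℝ) * a - l * b| < T), tentCoeff δ k
      ≤ tentCoeff ε l * ((2 * (T / a) + 1) * B) := by
    intro l _
    rcases Nat.eq_zero_or_pos l with rfl | hl
    · simp [tentCoeff_zero]
    refine mul_le_mul_of_nonneg_left ?_ (tentCoeff_nonneg hε l)
    have := sum_near_le (δ := δ) (L := L) ha hT hl hTb (B := B) fun k hk h => by
      refine (tentCoeff_le_inv hδ k).trans ?_
      refine mul_le_mul_of_nonneg_left ?_ (by positivity)
      have hl1 : (1 : ℝ) ≤ l := by exact_mod_cast hl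
      have hba : 0 < b / a := by positivity
      have : b / a / 2 ≤ k := by nlinarith
      calc ((k : ℝ) ^ 2)⁻¹ ≤ ((b / a / 2) ^ 2)⁻¹ := by gcongr
        _ = 4 * ((b / a) ^ 2)⁻¹ := by rw [div_pow, inv_div]; norm_num; ring
    rwa [max_eq_left hB0] at this
  refine (Finset.sum_le_sum h1).trans ?_
  rw [← Finset.sum_mul]
  exact mul_le_of_le_one_left (by positivity) (sum_tentCoeff_le_one hε hε1 _)

/-- Interpolates between the bounds `2 δ` and `δ⁻¹ k⁻²` with weights `3/4` and `1/4`, which yields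
the order `√δ / √k`. -/
theorem tentCoeff_le_sqrt {δ x : ℝ} (hδ : 0 ≤ δ) (hx : 0 < x) {k : ℕ} (hk : 0 < k)
    (h : x / 2 ≤ k) : tentCoeff δ k ≤ 4 * (√δ / √x) := by
  rcases hδ.eq_or_lt with rfl | hδ
  · simp [tentCoeff]
  have hk0 : (0 : ℝ) < k := by exact_mod_cast hk
  have b0 := tentCoeff_nonneg hδ.le k
  have b1 := tentCoeff_le_two_mul hδ.le k
  have b2 := tentCoeff_le_inv hδ.le k
  have hy : (0 : ℝ) < √x := Real.sqrt_pos.mpr hx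
  have hp : (0 : ℝ) < √δ := Real.sqrt_pos.mpr hδ
  have e1 : √δ ^ 2 = δ := Real.sq_sqrt hδ.le
  have e2 : √x ^ 2 = x := Real.sq_sqrt hx.le
  generalize tentCoeff δ k = a at *
  generalize √x = y at *
  generalize √δ = p at *
  subst e1 e2
  rw [← mul_div_assoc, le_div_iff₀ hy]
  rcases le_total (p * y) 2 with h2 | h2
  · calc a * y ≤ 2 * p ^ 2 * y := by gcongr
      _ = 2 * p * (p * y) := by ring
      _ ≤ 2 * p * 2 := by gcongr
      _ = 4 * p := by ring
  · have h3 : ((k : ℝ) ^ 2)⁻¹ ≤ ((y ^ 2 / 2) ^ 2)⁻¹ := by gcongr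
    have h4 : a ≤ (p ^ 2)⁻¹ * ((y ^ 2 / 2) ^ 2)⁻¹ := b2.trans (by gcongr)
    have h5 : (p ^ 2)⁻¹ * ((y ^ 2 / 2) ^ 2)⁻¹ * y = 4 * p / (p * y) ^ 3 := by
      field_simp
      norm_num
    have h6 : 1 ≤ (p * y) ^ 3 := one_le_pow₀ (by linarith)
    calc a * y ≤ (p ^ 2)⁻¹ * ((y ^ 2 / 2) ^ 2)⁻¹ * y := by gcongr
      _ = 4 * p / (p * y) ^ 3 := h5
      _ ≤ 4 * p := div_le_self (by positivity) h6

/-- The factor `1 / √l` from the interpolated bound is summed against the coefficients of `tent ε`,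
producing `√ε`. The resulting `√δ √ε` is at most the average of `δ` and `ε`, so it can be charged to
the mean of the count. -/
theorem nearSum_le_sqrt {δ ε a b T : ℝ} (hδ : 0 ≤ δ) (hε : 0 ≤ ε)
    (ha : 0 < a) (hb : 0 < b) (hT : 0 ≤ T) (hTb : T ≤ b / 2) (L : ℕ) :
    nearSum δ ε a b T L ≤ (2 * (T / a) + 1) * (64 * (√δ * √ε / √(b / a))) := by
  have h1 : ∀ l ∈ Finset.range L, tentCoeff ε l *
      ∑ k ∈ (Finset.range L).filter (fun k : ℕ => |(k : ℝ) * a - l * b| < T), tentCoeff δ k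
      ≤ (tentCoeff ε l / √(l : ℝ)) * ((2 * (T / a) + 1) * (4 * (√δ / √(b / a)))) := by
    intro l _
    rcases Nat.eq_zero_or_pos l with rfl | hl
    · simp [tentCoeff_zero]
    have hl0 : (0 : ℝ) < l := by exact_mod_cast hl
    have := sum_near_le (δ := δ) (L := L) ha hT hl hTb (B := 4 * (√δ / √(l * (b / a))))
      fun k hk h => tentCoeff_le_sqrt hδ (by positivity) hk h
    rw [max_eq_left (by positivity)] at this
    refine (mul_le_mul_of_nonneg_left this (tentCoeff_nonneg hε l)).trans (le_of_eq ?_)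
    rw [Real.sqrt_mul hl0.le]
    ring
  refine (Finset.sum_le_sum h1).trans ?_
  rw [← Finset.sum_mul]
  refine (mul_le_mul_of_nonneg_right (sum_tentCoeff_div_sqrt_le hε L) (by positivity)).trans
    (le_of_eq ?_)
  ring

/-! ### Means and covariances of tents under `μ`. -/

theorem integrable_of_continuous_of_abs_le {μ : Measure ℝ} [IsFiniteMeasure μ] {f : ℝ → ℝ}
    (hf : Continuous f) {C : ℝ} (hC : ∀ x, |f x| ≤ C) : Integrable f μ :=
  Integrable.of_bound hf.aestronglyMeasurable C (Eventually.of_forall hC)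

theorem abs_integral_tent_sub_le (μ : Measure ℝ) [IsProbabilityMeasure μ] {δ a γ D : ℝ}
    (h0 : 0 ≤ δ) (h1 : δ ≤ 1 / 2) (hD : 0 ≤ D)
    (hdec : ∀ k : ℕ, 0 < k → ‖fourierTransform μ (k * a)‖ ≤ D) :
    |∫ x, (tent δ (a * x - γ) - δ) ∂μ| ≤ D := by
  have hlim : Tendsto (fun L => ∫ x, tentPartial δ L (a * x - γ) ∂μ) atTop
      (𝓝 (∫ x, (tent δ (a * x - γ) - δ) ∂μ)) := by
    refine MeasureTheory.tendsto_integral_of_dominated_convergence (fun _ => (1 : ℝ))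
      (fun L => ((continuous_tentPartial δ L).comp (by fun_prop)).aestronglyMeasurable)
      (integrable_const _)
      (fun L => Eventually.of_forall fun x => abs_tentPartial_le_one h0 h1 L _)
      (Eventually.of_forall fun x => tendsto_tentPartial h0 h1 _)
  refine le_of_tendsto hlim.abs (Eventually.of_forall fun L => ?_)
  unfold tentPartial
  rw [integral_finsetSum _ fun k _ => integrable_of_continuous_of_abs_le (by fun_prop)
    (C := tentCoeff δ k) fun x => by
      rw [abs_mul, abs_of_nonneg (tentCoeff_nonneg h0 k)]
      exact mul_le_of_le_one_right (tentCoeff_nonneg h0 k) (Real.abs_cos_le_one _)]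
  calc |∑ k ∈ Finset.range L, ∫ x, tentCoeff δ k * Real.cos (2 * π * k * (a * x - γ)) ∂μ|
      ≤ ∑ k ∈ Finset.range L, |∫ x, tentCoeff δ k * Real.cos (2 * π * k * (a * x - γ)) ∂μ| :=
        Finset.abs_sum_le_sum_abs _ _
    _ ≤ ∑ k ∈ Finset.range L, tentCoeff δ k * D := by
        refine Finset.sum_le_sum fun k _ => ?_
        rw [integral_const_mul, abs_mul, abs_of_nonneg (tentCoeff_nonneg h0 k)]
        rcases Nat.eq_zero_or_pos k with rfl | hk
        · simp [tentCoeff_zero]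
        refine mul_le_mul_of_nonneg_left ?_ (tentCoeff_nonneg h0 k)
        have h := abs_integral_cos_le μ (k * a) (-(2 * π * k * γ))
        refine le_trans (le_of_eq ?_) (h.trans (hdec k hk))
        congr 2
        funext x
        congr 1
        ring
    _ ≤ D := by
        rw [← Finset.sum_mul]
        exact mul_le_of_le_one_left hD (sum_tentCoeff_le_one h0 h1 _)

/-- Product-to-sum: the frequency `k a + l b` is at least `b ≥ T` because `l ≥ 1`, so only the
difference can fall below `T`, where the trivial bound `1` is used. -/
theorem abs_integral_cos_mul_cos_le (μ : Measure ℝ) [IsProbabilityMeasure μ] {a b γ D T : ℝ}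
    (ha : 0 ≤ a) (hb : 0 < b) (hTb : T ≤ b) (hD : 0 ≤ D)
    (hdec : ∀ t, T ≤ |t| → ‖fourierTransform μ t‖ ≤ D) (k : ℕ) {l : ℕ} (hl : 0 < l) :
    |∫ x, Real.cos (2 * π * k * (a * x - γ)) * Real.cos (2 * π * l * (b * x - γ)) ∂μ|
      ≤ D + if |(k : ℝ) * a - l * b| < T then 1 else 0 := by
  have hl1 : (1 : ℝ) ≤ l := by exact_mod_cast hl
  have hcc (x : ℝ) : Real.cos (2 * π * k * (a * x - γ)) * Real.cos (2 * π * l * (b * x - γ)) =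
      (1 / 2) * (Real.cos (2 * π * ((k * a - l * b) * x) + 2 * π * (l - k) * γ) +
        Real.cos (2 * π * ((k * a + l * b) * x) + -(2 * π * (l + k) * γ))) := by
    have e1 : 2 * π * ((k * a - l * b) * x) + 2 * π * (l - k) * γ =
      2 * π * k * (a * x - γ) - 2 * π * l * (b * x - γ) := by ring
    have e2 : 2 * π * ((k * a + l * b) * x) + -(2 * π * (l + k) * γ) =
      2 * π * k * (a * x - γ) + 2 * π * l * (b * x - γ) := by ring
    rw [e1, e2, Real.cos_add, Real.cos_sub]
    ring
  simp_rw [hcc]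
  rw [integral_const_mul, integral_add
    (integrable_of_continuous_of_abs_le (by fun_prop) fun x => Real.abs_cos_le_one _)
    (integrable_of_continuous_of_abs_le (by fun_prop) fun x => Real.abs_cos_le_one _)]
  have h1 := abs_integral_cos_le μ (k * a - l * b) (2 * π * (l - k) * γ)
  have h2 := abs_integral_cos_le μ (k * a + l * b) (-(2 * π * (l + k) * γ))
  have h3 : ‖fourierTransform μ (k * a + l * b)‖ ≤ D := by
    refine hdec _ ?_
    rw [abs_of_nonneg (by positivity)]
    have : 0 ≤ k * a := by positivity
    nlinarith
  have h4 : ‖fourierTransform μ (k * a - l * b)‖ ≤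
      D + if |(k : ℝ) * a - l * b| < T then 1 else 0 := by
    split_ifs with h
    · linarith [norm_fourierTransform_le_one μ (k * a - l * b)]
    · rw [add_zero]; exact hdec _ (not_lt.mp h)
  have h5 : (0 : ℝ) ≤ if |(k : ℝ) * a - l * b| < T then 1 else 0 := by
    split_ifs <;> norm_num
  rw [abs_mul, abs_of_pos (by norm_num : (0 : ℝ) < 1 / 2)]
  have := abs_add_le (∫ x, Real.cos (2 * π * ((k * a - l * b) * x) + 2 * π * (l - k) * γ) ∂μ)
    (∫ x, Real.cos (2 * π * ((k * a + l * b) * x) + -(2 * π * (l + k) * γ)) ∂μ)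
  linarith

theorem abs_integral_tentPartial_mul_le (μ : Measure ℝ) [IsProbabilityMeasure μ]
    {δ ε a b γ D T : ℝ} (hδ : 0 ≤ δ) (hδ1 : δ ≤ 1 / 2) (hε : 0 ≤ ε) (hε1 : ε ≤ 1 / 2)
    (ha : 0 ≤ a) (hb : 0 < b) (hTb : T ≤ b) (hD : 0 ≤ D)
    (hdec : ∀ t, T ≤ |t| → ‖fourierTransform μ t‖ ≤ D) (L : ℕ) :
    |∫ x, tentPartial δ L (a * x - γ) * tentPartial ε L (b * x - γ) ∂μ|
      ≤ D + nearSum δ ε a b T L := by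
  have hexp (x : ℝ) : tentPartial δ L (a * x - γ) * tentPartial ε L (b * x - γ) =
      ∑ l ∈ Finset.range L, ∑ k ∈ Finset.range L, tentCoeff ε l * tentCoeff δ k *
        (Real.cos (2 * π * k * (a * x - γ)) * Real.cos (2 * π * l * (b * x - γ))) := by
    unfold tentPartial
    rw [mul_comm, Finset.sum_mul_sum]
    exact Finset.sum_congr rfl fun l _ => Finset.sum_congr rfl fun k _ => by ring
  have hint (l k : ℕ) : Integrable (fun x => tentCoeff ε l * tentCoeff δ k *
        (Real.cos (2 * π * k * (a * x - γ)) * Real.cos (2 * π * l * (b * x - γ)))) μ :=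
    (integrable_of_continuous_of_abs_le (by fun_prop) (C := 1) fun x => by
      rw [abs_mul]
      exact mul_le_one₀ (Real.abs_cos_le_one _) (abs_nonneg _) (Real.abs_cos_le_one _)).const_mul _
  simp_rw [hexp]
  rw [integral_finsetSum _ fun l _ => integrable_finsetSum _ fun k _ => hint l k]
  simp_rw [integral_finsetSum _ fun k _ => hint _ k, integral_const_mul]
  calc _ ≤ ∑ l ∈ Finset.range L, ∑ k ∈ Finset.range L, |tentCoeff ε l * tentCoeff δ k *
        ∫ x, Real.cos (2 * π * k * (a * x - γ)) * Real.cos (2 * π * l * (b * x - γ)) ∂μ| :=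
        (Finset.abs_sum_le_sum_abs _ _).trans
          (Finset.sum_le_sum fun l _ => Finset.abs_sum_le_sum_abs _ _)
    _ ≤ ∑ l ∈ Finset.range L, ∑ k ∈ Finset.range L, tentCoeff ε l * tentCoeff δ k *
        (D + if |(k : ℝ) * a - l * b| < T then 1 else 0) := by
        refine Finset.sum_le_sum fun l _ => Finset.sum_le_sum fun k _ => ?_
        have hnn := mul_nonneg (tentCoeff_nonneg hε l) (tentCoeff_nonneg hδ k)
        rw [abs_mul, abs_of_nonneg hnn]
        rcases Nat.eq_zero_or_pos l with rfl | hl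
        · simp [tentCoeff_zero]
        exact mul_le_mul_of_nonneg_left
          (abs_integral_cos_mul_cos_le μ ha hb hTb hD hdec k hl) hnn
    _ = (∑ l ∈ Finset.range L, tentCoeff ε l) * (∑ k ∈ Finset.range L, tentCoeff δ k) * D
        + nearSum δ ε a b T L := by
        unfold nearSum
        rw [Finset.sum_mul_sum, Finset.sum_mul, ← Finset.sum_add_distrib]
        refine Finset.sum_congr rfl fun l _ => ?_
        rw [Finset.sum_filter, Finset.mul_sum, Finset.sum_mul, ← Finset.sum_add_distrib]
        refine Finset.sum_congr rfl fun k _ => ?_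
        split_ifs <;> ring
    _ ≤ D + nearSum δ ε a b T L := by
        gcongr
        refine mul_le_of_le_one_left hD ?_
        exact mul_le_one₀ (sum_tentCoeff_le_one hε hε1 _)
          (Finset.sum_nonneg fun k _ => tentCoeff_nonneg hδ k) (sum_tentCoeff_le_one hδ hδ1 _)

theorem abs_integral_tent_mul_le (μ : Measure ℝ) [IsProbabilityMeasure μ]
    {δ ε a b γ D T B : ℝ} (hδ : 0 ≤ δ) (hδ1 : δ ≤ 1 / 2) (hε : 0 ≤ ε) (hε1 : ε ≤ 1 / 2)
    (ha : 0 ≤ a) (hb : 0 < b) (hTb : T ≤ b) (hD : 0 ≤ D)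
    (hdec : ∀ t, T ≤ |t| → ‖fourierTransform μ t‖ ≤ D)
    (hB : ∀ L, nearSum δ ε a b T L ≤ B) :
    |∫ x, (tent δ (a * x - γ) - δ) * (tent ε (b * x - γ) - ε) ∂μ| ≤ D + B := by
  have hlim : Tendsto
      (fun L => ∫ x, tentPartial δ L (a * x - γ) * tentPartial ε L (b * x - γ) ∂μ) atTop
      (𝓝 (∫ x, (tent δ (a * x - γ) - δ) * (tent ε (b * x - γ) - ε) ∂μ)) := by
    refine MeasureTheory.tendsto_integral_of_dominated_convergence (fun _ => (1 : ℝ))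
      (fun L => (((continuous_tentPartial δ L).comp (by fun_prop)).mul
        ((continuous_tentPartial ε L).comp (by fun_prop))).aestronglyMeasurable)
      (integrable_const _)
      (fun L => Eventually.of_forall fun x => ?_)
      (Eventually.of_forall fun x =>
        (tendsto_tentPartial hδ hδ1 _).mul (tendsto_tentPartial hε hε1 _))
    rw [norm_mul]
    exact mul_le_one₀ (abs_tentPartial_le_one hδ hδ1 L _) (norm_nonneg _)
      (abs_tentPartial_le_one hε hε1 L _)
  exact le_of_tendsto hlim.abs (Eventually.of_forall fun L =>
    (abs_integral_tentPartial_mul_le μ hδ hδ1 hε hε1 ha hb hTb hD hdec L).trans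
      (by linarith [hB L]))

/-- The covariance estimate for a lacunary sequence. -/
theorem abs_covariance_le (μ : Measure ℝ) [IsProbabilityMeasure μ] {q : ℕ → ℕ} {R C A γ : ℝ}
    (hq : ∀ n, 0 < q n) (hR : 1 < R)
    (hr : ∀ n, R ^ 2 ≤ (q (n + 1) : ℝ) / (q n : ℝ)) (hC : 0 < C)
    (hdec : ∀ (n : ℕ) (t : ℝ), R ^ n / 2 ≤ |t| →
      ‖fourierTransform μ t‖ ≤ C * ((n : ℝ) + 1) ^ (-A))
    {d : ℕ → ℝ} (hd0 : ∀ n, 0 ≤ d n) (hd1 : ∀ n, d n ≤ 1 / 2)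
    (hdi : ∀ n, (d n)⁻¹ ≤ 2 * ((n : ℝ) + 1) ^ 2) {m n : ℕ} (hmn : m < n) :
    |∫ x, (tent (d m) (q m * x - γ) - d m) * (tent (d n) (q n * x - γ) - d n) ∂μ| ≤
      C * ((n : ℝ) + 1) ^ (-A) + (16 * ((n : ℝ) + 1) ^ 2 * R⁻¹ ^ n +
        64 * (d m + d n) * R⁻¹ ^ (n - m)) := by
  have hR0 : 0 < R := by linarith
  have hK : 1 < R ^ 2 := one_lt_pow₀ hR (by norm_num)
  have ha : (0 : ℝ) < q m := by exact_mod_cast hq m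
  have hb : (0 : ℝ) < q n := by exact_mod_cast hq n
  have hqn := pow_le_of_ratio_zero hq hK hr n
  have hqm := pow_le_of_ratio_zero hq hK hr m
  have hqq := pow_le_of_ratio hq hK hr hmn.le
  have hRn : R ^ n ≤ q n := by
    refine le_trans ?_ hqn
    rw [← pow_mul]
    exact pow_le_pow_right₀ hR.le (by omega)
  have hT0 : 0 ≤ R ^ n / 2 := by positivity
  have hRpos : 0 < R ^ n := by positivity
  have hTb : R ^ n / 2 ≤ q n / 2 := by linarith
  have hsm := hd0 m
  have hsn := hd0 n
  have hrat : (R ^ 2) ^ (n - m) ≤ (q n : ℝ) / q m := by rwa [le_div_iff₀ ha]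
  refine abs_integral_tent_mul_le μ (hd0 m) (hd1 m) (hd0 n) (hd1 n) ha.le hb
    (by linarith) (by positivity) (hdec n) fun L => ?_
  -- If `n ≤ 2 m`, then `R ^ n ≤ q m`, so each `l` has boundedly many partners `k`, and `√(q n / q
  -- m) ≥ R ^ (n - m)` gives the decay. If `n > 2 m`, then `(q n / q m) ^ 2 ≥ R ^ (2 n)` outweighs
  -- both the window, of order at most `R ^ n`, and `(d m)⁻¹`.
  rcases le_or_gt n (2 * m) with h | h
  · refine (nearSum_le_sqrt (hd0 m) (hd0 n) ha hb hT0 hTb L).trans ?_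
    have h1 : 2 * (R ^ n / 2 / q m) ≤ 1 := by
      have : R ^ n ≤ q m := by
        refine le_trans ?_ hqm
        rw [← pow_mul]
        exact pow_le_pow_right₀ hR.le h
      have : R ^ n / q m ≤ 1 := (div_le_one ha).mpr this
      linarith [show 2 * (R ^ n / 2 / q m) = R ^ n / q m by ring]
    have h2 : R ^ (n - m) ≤ √((q n : ℝ) / q m) := by
      refine Real.le_sqrt_of_sq_le ?_
      rwa [← pow_mul, mul_comm, pow_mul]
    have h3 : √(d m) * √(d n) ≤ (d m + d n) / 2 := by
      have := sq_nonneg (√(d m) - √(d n))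
      nlinarith [Real.sq_sqrt (hd0 m), Real.sq_sqrt (hd0 n)]
    have h4 : √(d m) * √(d n) / √((q n : ℝ) / q m) ≤ (d m + d n) / 2 * R⁻¹ ^ (n - m) := by
      rw [inv_pow, ← div_eq_mul_inv]
      gcongr
    calc _ ≤ (1 + 1) * (64 * ((d m + d n) / 2 * R⁻¹ ^ (n - m))) := by gcongr
      _ = 64 * (d m + d n) * R⁻¹ ^ (n - m) := by ring
      _ ≤ _ := le_add_of_nonneg_left (by positivity)
  · refine (nearSum_le_inv (hd0 m) (hd0 n) (hd1 n) ha hb hT0 hTb L).trans ?_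
    have hq1 : (1 : ℝ) ≤ q m := by exact_mod_cast hq m
    have h1 : 2 * (R ^ n / 2 / q m) + 1 ≤ 2 * R ^ n := by
      have e : 2 * (R ^ n / 2 / q m) = R ^ n / q m := by ring
      have : R ^ n / q m ≤ R ^ n := div_le_self (by positivity) hq1
      have : 1 ≤ R ^ n := one_le_pow₀ hR.le
      linarith
    have h2 : R ^ n * R ^ n ≤ ((q n : ℝ) / q m) ^ 2 := by
      refine le_trans ?_ (pow_le_pow_left₀ (by positivity) hrat 2)
      rw [← pow_add, ← pow_mul, ← pow_mul]
      exact pow_le_pow_right₀ hR.le (by omega)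
    have h3 : (d m)⁻¹ ≤ 2 * ((n : ℝ) + 1) ^ 2 := by
      refine (hdi m).trans ?_
      have : (m : ℝ) ≤ n := by exact_mod_cast hmn.le
      gcongr
    have h4 : (((q n : ℝ) / q m) ^ 2)⁻¹ ≤ (R ^ n * R ^ n)⁻¹ := by gcongr
    calc _ ≤ 2 * R ^ n * (2 * ((n : ℝ) + 1) ^ 2 * (4 * (R ^ n * R ^ n)⁻¹)) := by gcongr
      _ = 16 * ((n : ℝ) + 1) ^ 2 * R⁻¹ ^ n := by
          rw [inv_pow]; field_simp; norm_num
      _ ≤ _ := le_add_of_nonneg_right (by positivity)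

/-! ### Summing the covariances: the second moment. -/

theorem sum_geometric_weights_succ (d : ℕ → ℝ) (r : ℝ) (n : ℕ) :
    ∑ m ∈ Finset.range (n + 1), d m * r ^ (n + 1 - m) =
      r * (∑ m ∈ Finset.range n, d m * r ^ (n - m) + d n) := by
  rw [Finset.sum_range_succ, mul_add, Finset.mul_sum]
  congr 1
  · refine Finset.sum_congr rfl fun m hm => ?_
    rw [Nat.sub_add_comm (Finset.mem_range.mp hm).le, pow_succ]
    ring
  · simp [mul_comm]

theorem sum_geometric_weights_le {r : ℝ} (h0 : 0 ≤ r) (h1 : r < 1) (n : ℕ) :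
    ∑ m ∈ Finset.range n, r ^ (n - m) ≤ (1 - r)⁻¹ := by
  have hc : (1 - r)⁻¹ * (1 - r) = 1 := inv_mul_cancel₀ (by linarith)
  induction n with
  | zero => simp; linarith
  | succ n ih =>
    have h := sum_geometric_weights_succ (fun _ => 1) r n
    simp only [one_mul] at h
    rw [h]
    nlinarith

theorem sum_sum_geometric_weights_le {d : ℕ → ℝ} (hd : ∀ n, 0 ≤ d n) {r : ℝ} (h0 : 0 ≤ r)
    (h1 : r < 1) (N : ℕ) :
    ∑ n ∈ Finset.range N, ∑ m ∈ Finset.range n, d m * r ^ (n - m) ≤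
      (1 - r)⁻¹ * ∑ n ∈ Finset.range N, d n := by
  have hc : (1 - r)⁻¹ * (1 - r) = 1 := inv_mul_cancel₀ (by linarith)
  have hc0 : 0 ≤ (1 - r)⁻¹ := inv_nonneg.mpr (by linarith)
  -- The extra term is what the `d m` with `m < N` would still contribute to all rows `n ≥ N`;
  -- including it makes the induction close.
  have key : ∑ n ∈ Finset.range N, ∑ m ∈ Finset.range n, d m * r ^ (n - m) +
      (1 - r)⁻¹ * ∑ m ∈ Finset.range N, d m * r ^ (N - m) ≤
      (1 - r)⁻¹ * ∑ n ∈ Finset.range N, d n := by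
    induction N with
    | zero => simp
    | succ N ih =>
      rw [sum_geometric_weights_succ, Finset.sum_range_succ, Finset.sum_range_succ (f := d)]
      generalize ∑ m ∈ Finset.range N, d m * r ^ (N - m) = G at *
      have h2 : (1 - r)⁻¹ * (r * (G + d N)) = (1 - r)⁻¹ * G - G + (1 - r)⁻¹ * d N - d N := by
        linear_combination (-(G + d N)) * hc
      linarith [hd N]
  have : 0 ≤ (1 - r)⁻¹ * ∑ m ∈ Finset.range N, d m * r ^ (N - m) :=
    mul_nonneg hc0 (Finset.sum_nonneg fun m _ => mul_nonneg (hd m) (pow_nonneg h0 _))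
  linarith

theorem sq_sum_range (g : ℕ → ℝ) (N : ℕ) :
    (∑ n ∈ Finset.range N, g n) ^ 2 =
      ∑ n ∈ Finset.range N, (g n ^ 2 + 2 * ∑ m ∈ Finset.range n, g m * g n) := by
  induction N with
  | zero => simp
  | succ N ih =>
    rw [Finset.sum_range_succ, add_sq, ih, Finset.sum_range_succ, ← Finset.sum_mul]
    ring

theorem summable_mul_decay {A r : ℝ} (hA : 2 < A) (h0 : 0 ≤ r) (h1 : r < 1) (C : ℝ) :
    Summable fun n : ℕ =>
      (2 * (n : ℝ) + 1) * (C * ((n : ℝ) + 1) ^ (-A) + 16 * ((n : ℝ) + 1) ^ 2 * r ^ n) := by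
  -- The weight `2 n + 1 = 2 (n + 1) - 1` raises the exponent to `1 - A`, which is below `-1`
  -- exactly when `A > 2`.
  have s0 : Summable fun n : ℕ => ((n : ℝ) + 1) ^ (1 - A) := by
    have := (summable_nat_add_iff 1).mpr (Real.summable_nat_rpow (p := 1 - A)|>.mpr (by linarith))
    simpa using this
  have s0' : Summable fun n : ℕ => ((n : ℝ) + 1) ^ (-A) := by
    have := (summable_nat_add_iff 1).mpr (Real.summable_nat_rpow (p := -A)|>.mpr (by linarith))
    simpa using this
  have hr : ‖r‖ < 1 := by rwa [Real.norm_of_nonneg h0]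
  have s1 := summable_pow_mul_geometric_of_norm_lt_one 0 hr
  have s2 := summable_pow_mul_geometric_of_norm_lt_one 1 hr
  have s3 := summable_pow_mul_geometric_of_norm_lt_one 2 hr
  have s4 := summable_pow_mul_geometric_of_norm_lt_one 3 hr
  have := (((s0.mul_left (2 * C)).add (s0'.mul_left (-C))).add
    (((s4.mul_left 32).add (s3.mul_left 80)).add ((s2.mul_left 64).add (s1.mul_left 16))))
  refine this.congr fun n => ?_
  have hn : (0 : ℝ) < (n : ℝ) + 1 := by positivity
  rw [show 1 - A = 1 + -A by ring, Real.rpow_add hn, Real.rpow_one]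
  ring

theorem abs_tent_sub_le_one {δ : ℝ} (h0 : 0 ≤ δ) (h1 : δ ≤ 1 / 2) (y : ℝ) :
    |tent δ y - δ| ≤ 1 := by
  rw [abs_le]
  constructor <;> linarith [tent_nonneg h0 y, tent_le_one h0 y]

theorem integral_tent_sub_sq_le (μ : Measure ℝ) [IsProbabilityMeasure μ] {δ a γ D : ℝ}
    (h0 : 0 ≤ δ) (h1 : δ ≤ 1 / 2) (hD : 0 ≤ D)
    (hdec : ∀ k : ℕ, 0 < k → ‖fourierTransform μ (k * a)‖ ≤ D) :
    ∫ x, (tent δ (a * x - γ) - δ) ^ 2 ∂μ ≤ 2 * δ + D := by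
  have hcont : Continuous fun x => tent δ (a * x - γ) - δ :=
    ((continuous_tent δ).comp (by fun_prop)).sub continuous_const
  have hint : Integrable (fun x => tent δ (a * x - γ) - δ) μ :=
    integrable_of_continuous_of_abs_le hcont fun x => abs_tent_sub_le_one h0 h1 _
  calc ∫ x, (tent δ (a * x - γ) - δ) ^ 2 ∂μ
      ≤ ∫ x, (2 * δ + (tent δ (a * x - γ) - δ)) ∂μ := by
        refine integral_mono (integrable_of_continuous_of_abs_le (hcont.pow 2) (C := 1) fun x => ?_)
          ((integrable_const _).add hint) fun x => ?_
        · rw [abs_pow]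
          exact pow_le_one₀ (abs_nonneg _) (abs_tent_sub_le_one h0 h1 _)
        -- For `t` in `[0, 1]`, `t ^ 2 ≤ t` gives `(t - δ) ^ 2 ≤ t + δ`.
        · have u0 := tent_nonneg h0 (a * x - γ)
          have u1 := tent_le_one h0 (a * x - γ)
          nlinarith [mul_nonneg u0 (sub_nonneg.mpr u1), mul_nonneg u0 h0,
            mul_nonneg h0 (sub_nonneg.mpr h1)]
    _ = 2 * δ + ∫ x, (tent δ (a * x - γ) - δ) ∂μ := by
        rw [integral_add (integrable_const _) hint]; simp
    _ ≤ 2 * δ + D := by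
        linarith [le_abs_self (∫ x, (tent δ (a * x - γ) - δ) ∂μ),
          abs_integral_tent_sub_le μ (γ := γ) h0 h1 hD hdec]

/-- The fluctuations of the counting function are of the order of the square root of its mean. -/
theorem exists_second_moment_bound (μ : Measure ℝ) [IsProbabilityMeasure μ] {q : ℕ → ℕ}
    {R C A γ : ℝ} (hA : 2 < A) (hq : ∀ n, 0 < q n) (hR : 1 < R)
    (hr : ∀ n, R ^ 2 ≤ (q (n + 1) : ℝ) / (q n : ℝ)) (hC : 0 < C)
    (hdec : ∀ (n : ℕ) (t : ℝ), R ^ n / 2 ≤ |t| →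
      ‖fourierTransform μ t‖ ≤ C * ((n : ℝ) + 1) ^ (-A))
    {d : ℕ → ℝ} (hd0 : ∀ n, 0 ≤ d n) (hd1 : ∀ n, d n ≤ 1 / 2)
    (hdi : ∀ n, (d n)⁻¹ ≤ 2 * ((n : ℝ) + 1) ^ 2) :
    ∃ W V : ℝ, 0 ≤ V ∧ ∀ N : ℕ,
      ∫ x, (∑ n ∈ Finset.range N, (tent (d n) (q n * x - γ) - d n)) ^ 2 ∂μ ≤
        W + V * ∑ n ∈ Finset.range N, d n := by
  have hr0 : 0 ≤ R⁻¹ := by positivity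
  have hr1 : R⁻¹ < 1 := inv_lt_one_of_one_lt₀ hR
  have hri : 0 ≤ (1 - R⁻¹)⁻¹ := inv_nonneg.mpr (by linarith)
  have hw := summable_mul_decay hA hr0 hr1 C
  set w : ℕ → ℝ := fun n => (2 * (n : ℝ) + 1) *
    (C * ((n : ℝ) + 1) ^ (-A) + 16 * ((n : ℝ) + 1) ^ 2 * R⁻¹ ^ n) with hwdef
  have hw0 : ∀ n, 0 ≤ w n := fun n => by positivity
  -- In the slope, `2` comes from the diagonal; `256 = 2 * 128` comes from the two halves of `64 (d
  -- m + d n)`, each doubled by symmetry.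
  refine ⟨∑' n, w n, 2 + 256 * (1 - R⁻¹)⁻¹, by positivity, fun N => ?_⟩
  set g : ℕ → ℝ → ℝ := fun n x => tent (d n) (q n * x - γ) - d n with hg
  have hgc (n : ℕ) : Continuous (g n) :=
    ((continuous_tent (d n)).comp (by fun_prop)).sub continuous_const
  have hgb (n : ℕ) (x : ℝ) : |g n x| ≤ 1 := abs_tent_sub_le_one (hd0 n) (hd1 n) _
  have hgg (m n : ℕ) : Integrable (fun x => g m x * g n x) μ :=
    integrable_of_continuous_of_abs_le ((hgc m).mul (hgc n)) (C := 1) fun x => by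
      rw [abs_mul]; exact mul_le_one₀ (hgb m x) (abs_nonneg _) (hgb n x)
  have hsq (n : ℕ) : Integrable (fun x => g n x ^ 2) μ := by
    simpa only [sq] using hgg n n
  have hcov (n : ℕ) : Integrable (fun x => 2 * ∑ m ∈ Finset.range n, g m x * g n x) μ :=
    (integrable_finsetSum _ fun m _ => hgg m n).const_mul 2
  have hterm (n : ℕ) : ∫ x, (g n x ^ 2 + 2 * ∑ m ∈ Finset.range n, g m x * g n x) ∂μ ≤
      w n + 2 * d n + 128 * ∑ m ∈ Finset.range n, d m * R⁻¹ ^ (n - m)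
        + 128 * (d n * ∑ m ∈ Finset.range n, R⁻¹ ^ (n - m)) := by
    rw [integral_add (hsq n) (hcov n), integral_const_mul,
      integral_finsetSum _ fun m _ => hgg m n]
    have h1 : ∫ x, g n x ^ 2 ∂μ ≤ 2 * d n + C * ((n : ℝ) + 1) ^ (-A) := by
      refine integral_tent_sub_sq_le μ (hd0 n) (hd1 n) (by positivity) fun k hk => hdec n _ ?_
      have hqn := pow_le_of_ratio_zero hq (one_lt_pow₀ hR (by norm_num)) hr n
      have hRn : R ^ n ≤ q n := by
        refine le_trans ?_ hqn
        rw [← pow_mul]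
        exact pow_le_pow_right₀ hR.le (by omega)
      have hk1 : (1 : ℝ) ≤ k := by exact_mod_cast hk
      have : 0 < R ^ n := by positivity
      rw [abs_of_nonneg (by positivity)]
      nlinarith
    have h2 : ∑ m ∈ Finset.range n, ∫ x, g m x * g n x ∂μ ≤
        ∑ m ∈ Finset.range n, (C * ((n : ℝ) + 1) ^ (-A) + (16 * ((n : ℝ) + 1) ^ 2 * R⁻¹ ^ n +
        64 * (d m + d n) * R⁻¹ ^ (n - m))) :=
      Finset.sum_le_sum fun m hm => (le_abs_self _).trans
        (abs_covariance_le μ hq hR hr hC hdec hd0 hd1 hdi (Finset.mem_range.mp hm))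
    have h3 : ∑ m ∈ Finset.range n, (C * ((n : ℝ) + 1) ^ (-A) +
        (16 * ((n : ℝ) + 1) ^ 2 * R⁻¹ ^ n + 64 * (d m + d n) * R⁻¹ ^ (n - m))) =
        n * (C * ((n : ℝ) + 1) ^ (-A) + 16 * ((n : ℝ) + 1) ^ 2 * R⁻¹ ^ n) +
        64 * ∑ m ∈ Finset.range n, d m * R⁻¹ ^ (n - m) +
        64 * (d n * ∑ m ∈ Finset.range n, R⁻¹ ^ (n - m)) := by
      rw [Finset.mul_sum, Finset.mul_sum, Finset.mul_sum, ← nsmul_eq_mul,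
        ← Finset.card_range n, ← Finset.sum_const, Finset.card_range, ← Finset.sum_add_distrib,
        ← Finset.sum_add_distrib]
      exact Finset.sum_congr rfl fun m _ => by ring
    rw [h3] at h2
    have h4 : 0 ≤ 16 * ((n : ℝ) + 1) ^ 2 * R⁻¹ ^ n := by positivity
    simp only [hwdef]
    linarith
  have hi (n : ℕ) :
      Integrable (fun x => g n x ^ 2 + 2 * ∑ m ∈ Finset.range n, g m x * g n x) μ :=
    (hsq n).add (hcov n)
  change ∫ x, (∑ n ∈ Finset.range N, g n x) ^ 2 ∂μ ≤ _
  simp_rw [sq_sum_range]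
  rw [integral_finsetSum _ fun n _ => hi n]
  refine (Finset.sum_le_sum fun n _ => hterm n).trans ?_
  rw [Finset.sum_add_distrib, Finset.sum_add_distrib, Finset.sum_add_distrib, ← Finset.mul_sum,
    ← Finset.mul_sum, ← Finset.mul_sum]
  have b1 := hw.sum_le_tsum (Finset.range N) fun n _ => hw0 n
  have b2 := sum_sum_geometric_weights_le hd0 hr0 hr1 N
  have b3 : ∑ n ∈ Finset.range N, d n * ∑ m ∈ Finset.range n, R⁻¹ ^ (n - m) ≤
      (1 - R⁻¹)⁻¹ * ∑ n ∈ Finset.range N, d n := by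
    rw [mul_comm, Finset.sum_mul]
    exact Finset.sum_le_sum fun n _ =>
      mul_le_mul_of_nonneg_left (sum_geometric_weights_le hr0 hr1 n) (hd0 n)
  linarith

/-! ### From moments to almost sure statements. -/

/-- Sums of nonnegative functions whose variance is bounded linearly by a divergent mean are
almost everywhere unbounded. -/
theorem ae_unbounded_of_second_moment (μ : Measure ℝ) [IsProbabilityMeasure μ]
    {f : ℕ → ℝ → ℝ} {d : ℕ → ℝ} (hf : ∀ n, Continuous (f n)) {c : ℝ}
    (hfb : ∀ n x, |f n x - d n| ≤ c)
    (hd : Tendsto (fun N => ∑ n ∈ Finset.range N, d n) atTop atTop) {W V : ℝ} (hV : 0 ≤ V)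
    (hvar : ∀ N : ℕ, ∫ x, (∑ n ∈ Finset.range N, (f n x - d n)) ^ 2 ∂μ ≤
        W + V * ∑ n ∈ Finset.range N, d n) :
    ∀ᵐ x ∂μ, ∀ M : ℕ, ∃ N : ℕ, (M : ℝ) < ∑ n ∈ Finset.range N, f n x := by
  rw [ae_all_iff]
  intro M
  rw [ae_iff]
  push Not
  set s : Set ℝ := {x | ∀ N : ℕ, ∑ n ∈ Finset.range N, f n x ≤ (M : ℝ)}
  have hs : MeasurableSet s := by
    have : s = ⋂ N : ℕ, {x | ∑ n ∈ Finset.range N, f n x ≤ (M : ℝ)} := by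
      ext x; simp [s]
    rw [this]
    exact MeasurableSet.iInter fun N =>
      (isClosed_le (continuous_finsetSum _ fun n _ => hf n) continuous_const).measurableSet
  -- Chebyshev: on `s` the sum stays below `M`, so it deviates from its mean by at least the mean
  -- minus `M`.
  have hbound : ∀ N : ℕ, (M : ℝ) ≤ ∑ n ∈ Finset.range N, d n →
      μ.real s * (∑ n ∈ Finset.range N, d n - M) ^ 2 ≤ W + V * ∑ n ∈ Finset.range N, d n := by
    intro N hN
    refine le_trans ?_ (hvar N)
    have : μ.real s * (∑ n ∈ Finset.range N, d n - M) ^ 2 =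
        ∫ x, s.indicator (fun _ => (∑ n ∈ Finset.range N, d n - M) ^ 2) x ∂μ := by
      rw [integral_indicator_const _ hs, smul_eq_mul]
    rw [this]
    refine integral_mono ((integrable_const _).indicator hs)
      (integrable_of_continuous_of_abs_le (C := ((N : ℝ) * c) ^ 2)
        ((continuous_finsetSum _ fun n _ => (hf n).sub continuous_const).pow 2) fun x => ?_)
      fun x => ?_
    · rw [abs_pow]
      refine pow_le_pow_left₀ (abs_nonneg _) ((Finset.abs_sum_le_sum_abs _ _).trans ?_) 2
      refine (Finset.sum_le_card_nsmul _ _ c fun n _ => hfb n x).trans (le_of_eq ?_)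
      simp
    · by_cases hx : x ∈ s
      · rw [indicator_of_mem hx]
        have h1 : ∑ n ∈ Finset.range N, f n x ≤ (M : ℝ) := hx N
        rw [Finset.sum_sub_distrib]
        nlinarith
      · rw [indicator_of_notMem hx]
        positivity
  by_contra hne
  have hpos : 0 < μ.real s := by
    rw [Measure.real, ENNReal.toReal_pos_iff]
    exact ⟨pos_iff_ne_zero.mpr hne, measure_lt_top _ _⟩
  set p := μ.real s
  -- Chosen so that `E y > W + V (y + M)` for all `y ≥ 1`, while a large mean forces `E y ≤ p y ^
  -- 2`.
  set E := |W + V * M| + V + 1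
  have hE : 0 < E := by positivity
  obtain ⟨N, hN⟩ := (hd.eventually_ge_atTop (M + 1 + E / p)).exists
  have hEp : 0 < E / p := by positivity
  have h := hbound N (by linarith)
  set y := ∑ n ∈ Finset.range N, d n - M with hy
  have hy1 : 1 ≤ y := by linarith
  have hyE : E ≤ p * y := by
    have : E / p ≤ y := by linarith
    rwa [div_le_iff₀ hpos, mul_comm] at this
  have h1 : E * y ≤ p * y ^ 2 := by nlinarith
  have h2 : ∑ n ∈ Finset.range N, d n = y + M := by rw [hy]; ring
  rw [h2] at h
  have h3 : E * y = |W + V * M| * y + V * y + y := by simp only [E]; ring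
  have h4 := le_abs_self (W + V * M)
  have h5 : |W + V * M| ≤ |W + V * M| * y := le_mul_of_one_le_right (abs_nonneg _) hy1
  nlinarith

/-- On the set, the tent of width `2 ε` is at least `1 / 2`, so twice this tent dominates the
indicator. The width must be at most `1 / 2`; for `ε > 1 / 4` the bound exceeds `1`. -/
theorem measureReal_distInt_le (μ : Measure ℝ) [IsProbabilityMeasure μ] {ε a γ D : ℝ}
    (h0 : 0 < ε) (hD : 0 ≤ D)
    (hdec : ∀ k : ℕ, 0 < k → ‖fourierTransform μ (k * a)‖ ≤ D) :
    μ.real {x | distInt (a * x - γ) ≤ ε} ≤ 4 * ε + 2 * D := by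
  rcases le_or_gt ε (1 / 4) with h | h
  swap
  · exact measureReal_le_one.trans (by linarith)
  set s : Set ℝ := {x | distInt (a * x - γ) ≤ ε}
  have hs : MeasurableSet s :=
    (isClosed_le (continuous_distInt.comp (by fun_prop)) continuous_const).measurableSet
  have h20 : 0 ≤ 2 * ε := by linarith
  have h21 : 2 * ε ≤ 1 / 2 := by linarith
  have hcont : Continuous fun x => tent (2 * ε) (a * x - γ) - 2 * ε :=
    ((continuous_tent _).comp (by fun_prop)).sub continuous_const
  have hint : Integrable (fun x => tent (2 * ε) (a * x - γ) - 2 * ε) μ :=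
    integrable_of_continuous_of_abs_le hcont fun x => abs_tent_sub_le_one h20 h21 _
  calc μ.real s = ∫ x, s.indicator (fun _ => (1 : ℝ)) x ∂μ := by
        rw [integral_indicator_const _ hs, smul_eq_mul, mul_one]
    _ ≤ ∫ x, (4 * ε + 2 * (tent (2 * ε) (a * x - γ) - 2 * ε)) ∂μ := by
        refine integral_mono ((integrable_const _).indicator hs)
          ((integrable_const _).add (hint.const_mul 2)) fun x => ?_
        by_cases hx : x ∈ s
        · rw [indicator_of_mem hx]
          have hx' : distInt (a * x - γ) ≤ ε := hx
          have : 1 / 2 ≤ tent (2 * ε) (a * x - γ) := by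
            rw [tent, le_div_iff₀ (by linarith)]
            exact le_trans (by linarith) (le_max_right _ _)
          simp only
          linarith
        · rw [indicator_of_notMem hx]
          have := tent_nonneg h20 (a * x - γ)
          simp only
          linarith
    _ = 4 * ε + 2 * ∫ x, (tent (2 * ε) (a * x - γ) - 2 * ε) ∂μ := by
        rw [integral_add (integrable_const _) (hint.const_mul 2), integral_const_mul (2 : ℝ)]; simp
    _ ≤ 4 * ε + 2 * D := by
        linarith [le_abs_self (∫ x, (tent (2 * ε) (a * x - γ) - 2 * ε) ∂μ),
          abs_integral_tent_sub_le μ (γ := γ) h20 h21 hD hdec]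

/-- A truncation of a sequence with divergent sum, which stays away from zero where it does not
vanish. -/
theorem exists_truncation {p : ℕ → ℝ} (hp : ∀ n, 0 < p n) (hdiv : ¬ Summable p) :
    ∃ d : ℕ → ℝ, (∀ n, 0 ≤ d n) ∧ (∀ n, d n ≤ 1 / 2) ∧ (∀ n, d n ≤ p n) ∧
      (∀ n, (d n)⁻¹ ≤ 2 * ((n : ℝ) + 1) ^ 2) ∧
      Tendsto (fun N => ∑ n ∈ Finset.range N, d n) atTop atTop := by
  have hinv : Summable fun n : ℕ => (((n : ℝ) + 1) ^ 2)⁻¹ := by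
    simpa using (summable_nat_add_iff 1).mpr (Real.summable_nat_pow_inv (p := 2) |>.mpr one_lt_two)
  -- Discarded terms are below `1 / (n + 1) ^ 2`, hence summable, so divergence survives. At the
  -- discarded indices `d n = 0` and `(d n)⁻¹ = 0`.
  set d : ℕ → ℝ := fun n => if (((n : ℝ) + 1) ^ 2)⁻¹ ≤ p n then min (p n) (1 / 2) else 0 with hd
  have hd0 : ∀ n, 0 ≤ d n := fun n => by
    simp only [hd]
    split_ifs
    · exact le_min (hp n).le (by norm_num)
    · exact le_rfl
  refine ⟨d, hd0, fun n => ?_, fun n => ?_, fun n => ?_, ?_⟩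
  · simp only [hd]
    split_ifs
    · exact min_le_right _ _
    · norm_num
  · simp only [hd]
    split_ifs
    · exact min_le_left _ _
    · exact (hp n).le
  · simp only [hd]
    have h1 : (1 : ℝ) ≤ ((n : ℝ) + 1) ^ 2 := one_le_pow₀ (by linarith [n.cast_nonneg (α := ℝ)])
    split_ifs with h
    · refine inv_le_of_inv_le₀ (by positivity) (le_min (le_trans ?_ h) ?_)
      · gcongr
        linarith
      · rw [inv_le_comm₀ (by positivity) (by norm_num),
          show ((1 : ℝ) / 2)⁻¹ = 2 by norm_num]
        linarith
    · rw [inv_zero]; positivity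
  · rw [← not_summable_iff_tendsto_nat_atTop_of_nonneg hd0]
    intro hs
    apply hdiv
    have hmin : Summable fun n => min (p n) (1 / 2) := by
      refine Summable.of_nonneg_of_le (fun n => le_min (hp n).le (by norm_num)) (fun n => ?_)
        (hs.add hinv)
      simp only [hd]
      split_ifs with h
      · exact le_add_of_nonneg_right (by positivity)
      · rw [zero_add]; exact (min_le_left _ _).trans (not_le.mp h).le
    -- A summable `min (p n) (1 / 2)` tends to zero, so the cap is eventually inactive and `p`
    -- itself would be summable.
    have hev : ∀ᶠ n in atTop, min (p n) (1 / 2) < 1 / 2 :=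
      hmin.tendsto_atTop_zero.eventually_lt_const (by norm_num)
    refine hmin.congr_atTop (hev.mono fun n hn => ?_)
    exact min_eq_left ((min_lt_iff.mp hn).resolve_right (lt_irrefl _)).le

theorem infinite_of_unbounded_sum {f : ℕ → ℝ} (hf : ∀ n, 0 ≤ f n)
    (h : ∀ M : ℕ, ∃ N : ℕ, (M : ℝ) < ∑ n ∈ Finset.range N, f n) : {n | 0 < f n}.Infinite := by
  intro hfin
  have hs : Summable f := by
    refine summable_of_ne_finset_zero (s := hfin.toFinset) fun n hn => ?_
    by_contra hne
    exact hn (hfin.mem_toFinset.mpr (lt_of_le_of_ne (hf n) (Ne.symm hne)))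
  obtain ⟨M, hM⟩ := exists_nat_ge (∑' n, f n)
  obtain ⟨N, hN⟩ := h M
  linarith [hs.sum_le_tsum (Finset.range N) fun n _ => hf n]

end LacunaryApprox

/-! ### The convergence and divergence cases. -/

theorem corollary1 (μ : Measure ℝ) [IsProbabilityMeasure μ]
    (F : Set ℝ) (hF : F ⊆ Set.Icc (0 : ℝ) 1) (hμF : μ Fᶜ = 0)
    (q : ℕ → ℕ) (hq : LacunaryApprox.IsLacunary q)
    (γ : ℝ) (hγ : γ ∈ Set.Icc (0 : ℝ) 1)
    (ψ : ℕ → ℝ) (hψ : ∀ m : ℕ, 0 < m → 0 < ψ m ∧ ψ m ≤ 1)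
    (A : ℝ) (hA : 2 < A)
    (hdecay : LacunaryApprox.fourierTransform μ
      =O[cocompact ℝ] fun t : ℝ => (Real.log |t|) ^ (-A)) :
    ((Summable fun n : ℕ => ψ (q n)) →
      μ (LacunaryApprox.wellApproximable q γ ψ ∩ F) = 0) ∧
    ((¬ Summable fun n : ℕ => ψ (q n)) →
      μ (LacunaryApprox.wellApproximable q γ ψ ∩ F) = 1) := by
  open LacunaryApprox in
  obtain ⟨hq0, K, hK, hr⟩ := hq
  have hR : 1 < √K := by rwa [Real.lt_sqrt zero_le_one, one_pow]
  have hRK : √K ^ 2 = K := Real.sq_sqrt (by linarith)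
  have hr' : ∀ n, √K ^ 2 ≤ (q (n + 1) : ℝ) / (q n : ℝ) := by rwa [hRK]
  obtain ⟨C, hC, hdec⟩ := exists_decay_bound μ (by linarith) hR hdecay
  have hp : ∀ n, 0 < ψ (q n) := fun n => (hψ _ (hq0 n)).1
  constructor
  · intro hsum
    have hmeas (n : ℕ) : μ {x | distInt (q n * x - γ) ≤ ψ (q n)} ≤
        ENNReal.ofReal (4 * ψ (q n) + 2 * (C * ((n : ℝ) + 1) ^ (-A))) := by
      rw [← ofReal_measureReal]
      refine ENNReal.ofReal_le_ofReal
        (measureReal_distInt_le μ (hp n) (by positivity) fun k hk => hdec n _ ?_)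
      have hqn := pow_le_of_ratio_zero hq0 hK hr n
      have hRn : √K ^ n ≤ K ^ n := by
        refine pow_le_pow_left₀ (by positivity) ?_ n
        nlinarith
      have hk1 : (1 : ℝ) ≤ k := by exact_mod_cast hk
      have : 0 < √K ^ n := by positivity
      rw [abs_of_nonneg (by positivity)]
      nlinarith
    have hs : Summable fun n : ℕ => 4 * ψ (q n) + 2 * (C * ((n : ℝ) + 1) ^ (-A)) := by
      refine (hsum.mul_left 4).add (Summable.mul_left 2 (Summable.mul_left C ?_))
      have := (summable_nat_add_iff 1).mpr
        (Real.summable_nat_rpow (p := -A) |>.mpr (by linarith))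
      simpa using this
    -- First Borel–Cantelli lemma.
    have h0 := measure_setOfPred_frequently_eq_zero (μ := μ)
      (p := fun n x => distInt (q n * x - γ) ≤ ψ (q n))
      (ne_top_of_le_ne_top hs.tsum_ofReal_ne_top (ENNReal.tsum_le_tsum hmeas))
    refine measure_mono_null (fun x hx => ?_) h0
    exact Nat.frequently_atTop_iff_infinite.mpr hx.1.2
  · intro hdiv
    obtain ⟨d, hd0, hd1, hdp, hdi, hd⟩ := exists_truncation hp hdiv
    obtain ⟨W, V, hV, hvar⟩ :=
      exists_second_moment_bound μ (γ := γ) hA hq0 hR hr' hC hdec hd0 hd1 hdi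
    have hae := ae_unbounded_of_second_moment μ
      (f := fun n x => tent (d n) (q n * x - γ)) (d := d) (c := 1)
      (fun n => (continuous_tent _).comp (by fun_prop))
      (fun n x => abs_tent_sub_le_one (hd0 n) (hd1 n) _) hd hV hvar
    have hFae : ∀ᵐ x ∂μ, x ∈ F := mem_ae_iff.mpr hμF
    have hmem : ∀ᵐ x ∂μ, x ∈ wellApproximable q γ ψ ∩ F := by
      filter_upwards [hae, hFae] with x hx hxF
      refine ⟨⟨hF hxF, ?_⟩, hxF⟩
      -- An unbounded sum has infinitely many positive terms, and a positive tent value forces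
      -- `distInt < d n ≤ ψ (q n)`; indices with `d n = 0` contribute nothing.
      refine (infinite_of_unbounded_sum (fun n => tent_nonneg (hd0 n) _) hx).mono fun n hn => ?_
      exact (distInt_lt_of_tent_pos hn).le.trans (hdp n)
    have huniv : (wellApproximable q γ ψ ∩ F : Set ℝ) =ᵐ[μ] Set.univ := eventuallyEq_univ.mpr hmem
    rw [measure_congr huniv, measure_univ]
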